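/- Let $n_1,n_2\ge 1$ and $m\ge 2$ be integers. For a finite directed multigraph $X$ (loops and parallel edges allowed), let $\mathrm{Dist}(X,m)$ be the polytope of all families consisting of a probability vector $p_x=(p_x^a)_{a\in\mathbb{Z}_m}$ for each node $x$ and a probability matrix $p_\sigma=(p_\sigma^{a,b})_{a,b\in\mathbb{Z}_m}$ for each edge $\sigma$ such that, for every edge $\sigma$ from $x$ to $y$, $\sum_b p_\sigma^{a,b}=p_x^a$ for all $a$ and $\sum_a p_\sigma^{a,b}=p_y^b$ for all $b$. An element of $\mathrm{Dist}(X,m)$ is deterministic if all its vectors and matrices have a single nonzero entry (equal to $1$), and contextual if it is not a convex combination of deterministic elements; a contextual vertex is a vertex of the polytope $\mathrm{Dist}(X,m)$ that is contextual. A matrix $p_\sigma$ is collapsed if $p_\sigma^{a,b}=0$ whenever $a\ne b$. Let $R_n$ be the rose graph with one node and $n$ loops ($R_0$ is a single node), and let $\tilde\kappa^{(1)}(n,m)$ be the number of contextual vertices $p$ of $\mathrm{Dist}(R_n,m)$ such that $p_\sigma$ is not collapsed for any loop $\sigma$. Let $K_{n_1,n_2}$ be the complete bipartite graph with parts of sizes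 $n_1$ and $n_2$, every edge directed from the first part to the second. Then $\mathrm{Dist}(K_{n_1,n_2},m)$ has at least $$\tilde\kappa^{(1)}\bigl((n_1-1)(n_2-1),\,m\bigr)\cdot n_1^{\,n_2-1}\,n_2^{\,n_1-1}$$ contextual vertices. -/

import Mathlib

/-- A directed multigraph with node type `V` and edge type `E`; loops and parallel edges are
allowed. (`src` is the face map `d₁`, `tgt` is the face map `d₀`.) -/
structure DiMultigraph (V E : Type*) where
  src : E → V
  tgt : E → V

namespace DiMultigraph

/-- The complete bipartite graph, every edge directed from the first part to the second. -/
def completeBipartite (n₁ n₂ : ℕ) : DiMultigraph (Fin n₁ ⊕ Fin n₂) (Fin n₁ × Fin n₂) where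
  src e := Sum.inl e.1
  tgt e := Sum.inr e.2

/-- The rose graph: one node and `n` loops (for `n = 0` a single node without loops). -/
def rose (n : ℕ) : DiMultigraph Unit (Fin n) where
  src _ := ()
  tgt _ := ()

variable {V E : Type*}

/-- The polytope of graph distributions on `X` with `m` outcomes: a probability vector `p.1 x` at
every node and a probability matrix `p.2 e` on every edge, whose row sums give the vector at the
source and whose column sums give the vector at the target. -/
def distPolytope (X : DiMultigraph V E) (m : ℕ) :
    Set ((V → Fin m → ℝ) × (E → Fin m × Fin m → ℝ)) :=
  {p | (∀ x, p.1 x ∈ stdSimplex ℝ (Fin m)) ∧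
       (∀ e, p.2 e ∈ stdSimplex ℝ (Fin m × Fin m)) ∧
       (∀ e a, p.1 (X.src e) a = ∑ b, p.2 e (a, b)) ∧
       (∀ e b, p.1 (X.tgt e) b = ∑ a, p.2 e (a, b))}

/-- The deterministic distributions: all probability vectors and matrices are point masses. -/
def deterministic (X : DiMultigraph V E) (m : ℕ) :
    Set ((V → Fin m → ℝ) × (E → Fin m × Fin m → ℝ)) :=
  {p | p ∈ X.distPolytope m ∧
       (∀ x, ∃ a, p.1 x = Pi.single a 1) ∧ (∀ e, ∃ ab, p.2 e = Pi.single ab 1)}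

/-- The contextual vertices: the vertices of the polytope of distributions that are not convex
combinations of deterministic distributions. -/
def contextualVertices (X : DiMultigraph V E) (m : ℕ) :
    Set ((V → Fin m → ℝ) × (E → Fin m × Fin m → ℝ)) :=
  {p | p ∈ (X.distPolytope m).extremePoints ℝ ∧ p ∉ convexHull ℝ (X.deterministic m)}

end DiMultigraph

/-- A distribution on pairs of outcomes is collapsed if it vanishes off the diagonal. -/
def IsCollapsed {m : ℕ} (Q : Fin m × Fin m → ℝ) : Prop :=
  ∀ a b, a ≠ b → Q (a, b) = 0

/-- The number of contextual vertices on the rose graph with `n` loops and `m` outcomes that are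
not collapsed on any loop. -/
noncomputable def kappaTilde (n m : ℕ) : ℕ∞ :=
  {p | p ∈ (DiMultigraph.rose n).contextualVertices m ∧ ∀ i, ¬ IsCollapsed (p.2 i)}.encard

/-!
Let `X` be a connected graph and `T` a spanning tree of `X`. A distribution on `X` that is collapsed
on `T` has the same marginal at every node, so contracting `T` identifies the distributions that
are collapsed on `T` with the distributions on the rose whose loops are the edges outside `T`. These
distributions form a face of the polytope, since being collapsed is the vanishing of nonnegative
coordinates; hence contextual vertices on the rose become contextual vertices on `X`. If the vertex
on the rose is not collapsed on any loop, then `T` can be recovered from the vertex on `X` as the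
set of edges on which it is collapsed, so different spanning trees give different vertices.

The spanning trees are counted by the matrix-tree theorem, which follows from the Cauchy–Binet
formula and the total unimodularity of the incidence matrix. For `completeBipartite n₁ n₂` the
determinant of the reduced Laplacian is `n₁ ^ (n₂ - 1) * n₂ ^ (n₁ - 1)` by a Schur complement.
-/

open Finset Function Matrix

section CauchyBinet

variable {ι E R : Type*} [Fintype ι] [DecidableEq ι] [Fintype E] [CommRing R]

theorem det_mul_eq_sum_prod_mul_det (M : Matrix ι E R) (N : Matrix E ι R) :
    (M * N).det = ∑ f : ι → E, (∏ i, M i (f i)) * (N.submatrix f id).det := by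
  classical
  have hrows : M * N = fun i ↦ ∑ e, M i e • N e := by
    ext i j
    simp [mul_apply]
  rw [hrows]
  refine (detRowAlternating.toMultilinearMap.map_sum fun i e ↦ M i e • N e).trans ?_
  exact sum_congr rfl fun f _ ↦ detRowAlternating.toMultilinearMap.map_smul_univ _ _

/-- The Cauchy–Binet formula, with a sum over all maps `f` instead of one over the subsets of `E` of
the size of `ι`: this avoids ordering the subsets and counts every subset `(card ι)!` times. -/
theorem factorial_card_mul_det_mul (M : Matrix ι E R) (N : Matrix E ι R) :
    (Fintype.card ι).factorial * (M * N).det =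
      ∑ f : ι → E, (M.submatrix id f).det * (N.submatrix f id).det := by
  have hperm (σ : Equiv.Perm ι) :
      (M * N).det =
        ∑ f : ι → E, Equiv.Perm.sign σ * (∏ i, M (σ i) (f i)) * (N.submatrix f id).det := by
    rw [det_mul_eq_sum_prod_mul_det, ← (σ.arrowCongr (Equiv.refl E)).sum_comp]
    refine sum_congr rfl fun f _ ↦ ?_
    have hdet : (N.submatrix (f ∘ σ.symm) id).det =
        Equiv.Perm.sign σ * (N.submatrix f id).det := by
      rw [← Equiv.Perm.sign_symm, ← det_permute σ.symm, submatrix_submatrix]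
      rfl
    have hprod : ∏ i, M i (f (σ.symm i)) = ∏ i, M (σ i) (f i) := by
      refine Fintype.prod_equiv σ.symm _ _ fun i ↦ ?_
      rw [σ.apply_symm_apply]
    change (∏ i, M i (f (σ.symm i))) * (N.submatrix (f ∘ σ.symm) id).det = _
    rw [hdet, hprod]
    ring
  calc (Fintype.card ι).factorial * (M * N).det = ∑ _σ : Equiv.Perm ι, (M * N).det := by
        rw [sum_const, card_univ, Fintype.card_perm, nsmul_eq_mul]
    _ = ∑ f : ι → E, ∑ σ : Equiv.Perm ι,
          Equiv.Perm.sign σ * (∏ i, M (σ i) (f i)) * (N.submatrix f id).det := by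
        rw [sum_comm]
        exact sum_congr rfl fun σ _ ↦ hperm σ
    _ = ∑ f : ι → E, (M.submatrix id f).det * (N.submatrix f id).det := by
        simp only [← sum_mul, det_apply', submatrix_apply, id_eq]

end CauchyBinet

theorem card_filter_image_univ_eq {ι E : Type*} [Fintype ι] [DecidableEq ι] [Fintype E]
    [DecidableEq E] {S : Finset E} (hS : #S = Fintype.card ι) :
    #{f : ι → E | univ.image f = S} = (Fintype.card ι).factorial := by
  have e : ι ≃ S := Fintype.equivOfCardEq (by simp [hS])
  rw [← Fintype.card_equiv e, ← card_univ]
  symm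
  refine card_bij (fun g _ i ↦ (g i : E)) (fun g _ ↦ ?_) (fun g _ h _ hgh ↦ ?_) fun f hf ↦ ?_
  · rw [mem_filter_univ]
    calc univ.image (fun i ↦ (g i : E)) = (univ.image g).image Subtype.val := image_image.symm
      _ = S := by rw [image_univ_equiv, univ_eq_attach, attach_image_val]
  · exact Equiv.ext fun i ↦ Subtype.ext (congrFun hgh i)
  · have hfS : univ.image f = S := (mem_filter.mp hf).2
    have hinj : Injective f := by
      rw [← Set.injOn_univ, ← coe_univ, ← card_image_iff, hfS, hS, card_univ]
    let g (i : ι) : S := ⟨f i, hfS ▸ mem_image_of_mem f (mem_univ i)⟩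
    have hg : Bijective g :=
      (Fintype.bijective_iff_injective_and_card g).mpr
        ⟨fun i j h ↦ hinj (congrArg Subtype.val h), by simp [hS]⟩
    exact ⟨Equiv.ofBijective g hg, mem_univ _, rfl⟩

theorem card_filter_image_univ_mem {ι E : Type*} [Fintype ι] [DecidableEq ι] [Fintype E]
    [DecidableEq E] {T : Finset (Finset E)} (hT : ∀ S ∈ T, #S = Fintype.card ι) :
    #{f : ι → E | univ.image f ∈ T} = #T * (Fintype.card ι).factorial := by
  rw [card_eq_sum_card_fiberwise (f := fun f ↦ univ.image f) (t := T) fun f hf ↦ by simpa using hf]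
  refine sum_const_nat fun S hS ↦ ?_
  rw [← card_filter_image_univ_eq (hT S hS), filter_filter]
  congr 1
  ext f
  simp +contextual [hS]

theorem card_add_one_of_range_eq_compl_singleton {W V : Type*} [Fintype W] [Fintype V] {ι : W ↪ V}
    {r : V} (hι : Set.range ι = {r}ᶜ) : Fintype.card W + 1 = Fintype.card V := by
  have hrange : (Set.range ι).ncard = Fintype.card W := by
    rw [← Set.image_univ, Set.ncard_image_of_injective _ ι.injective, Set.ncard_univ,
      Nat.card_eq_fintype_card]
  rw [← Nat.card_eq_fintype_card (α := V), ← Set.ncard_add_ncard_compl (Set.range ι), hrange, hι,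
    compl_compl, Set.ncard_singleton]

theorem det_fromBlocks_smul_one_neg_one {α β K : Type*} [Fintype α] [Fintype β] [DecidableEq α]
    [DecidableEq β] [Field K] {a b : K} (ha : a ≠ 0) (hb : b ≠ 0) :
    (fromBlocks (a • (1 : Matrix α α K)) (of fun _ _ ↦ -1) (of fun _ _ ↦ -1)
      (b • (1 : Matrix β β K))).det =
      a ^ Fintype.card α * b ^ Fintype.card β *
        (1 - Fintype.card α * Fintype.card β / (a * b)) := by
  let _ : Invertible (a • (1 : Matrix α α K)) :=
    ⟨a⁻¹ • 1, by simp [smul_smul, ha], by simp [smul_smul, ha]⟩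
  have hinv : ⅟(a • (1 : Matrix α α K)) = a⁻¹ • 1 := rfl
  have hschur : b • (1 : Matrix β β K) -
      (of fun _ _ ↦ -1 : Matrix β α K) * ⅟(a • (1 : Matrix α α K)) *
        (of fun _ _ ↦ -1 : Matrix α β K) =
        b • (1 + replicateCol Unit (fun _ : β ↦ -(Fintype.card α / (a * b))) *
          replicateRow Unit (fun _ : β ↦ (1 : K))) := by
    rw [hinv]
    ext i j
    simp only [Matrix.mul_smul, Matrix.mul_one, smul_of, Matrix.sub_apply, Matrix.smul_apply,
      smul_eq_mul, mul_apply, of_apply, Pi.smul_apply, mul_neg, mul_one, neg_neg, sum_const,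
      card_univ, nsmul_eq_mul, replicateCol, replicateRow, Matrix.add_apply, univ_unique,
      card_singleton, one_smul]
    field_simp
    ring
  rw [det_fromBlocks₁₁, hschur, det_smul, det_smul, det_one_add_replicateCol_mul_replicateRow]
  simp only [dotProduct, det_one, mul_one, sum_const, card_univ, nsmul_eq_mul, one_mul]
  ring

namespace DiMultigraph

variable {V E W : Type*}

/-- The oriented incidence matrix: the column of an edge has entry `1` at its source, `-1` at its
target, and is zero for a loop. -/
def incMatrix (R : Type*) [Ring R] [DecidableEq V] (X : DiMultigraph V E) : Matrix V E R :=
  of fun x e ↦ (if X.src e = x then 1 else 0) - (if X.tgt e = x then 1 else 0)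

/-- The edges in `S` connect all nodes, irrespective of their directions. -/
def Connects (X : DiMultigraph V E) (S : Finset E) : Prop :=
  ∀ x y, Relation.EqvGen (fun x y ↦ ∃ e ∈ S, X.src e = x ∧ X.tgt e = y) x y

/-- The edge sets of the spanning trees, a tree being encoded as a connected graph with one edge
less than it has nodes. -/
def spanningTrees [Fintype V] (X : DiMultigraph V E) : Set (Finset E) :=
  {S | X.Connects S ∧ #S + 1 = Fintype.card V}

theorem connects_iff_forall_eq {X : DiMultigraph V E} {S : Finset E} (α : Type*) [Nontrivial α] :
    X.Connects S ↔
      ∀ u : V → α, (∀ e ∈ S, u (X.src e) = u (X.tgt e)) → ∀ x y, u x = u y := by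
  classical
  refine ⟨fun hS u hu x y ↦ ?_, fun h x y ↦ ?_⟩
  · induction hS x y with
    | rel _ _ hxy =>
      obtain ⟨e, he, rfl, rfl⟩ := hxy
      exact hu e he
    | refl => rfl
    | symm _ _ _ ih => exact ih.symm
    | trans _ _ _ _ _ ih₁ ih₂ => exact ih₁.trans ih₂
  · obtain ⟨a, b, hab⟩ := exists_pair_ne α
    let Joined := Relation.EqvGen fun x y ↦ ∃ e ∈ S, X.src e = x ∧ X.tgt e = y
    let u (z : V) : α := if Joined x z then a else b
    have hu : ∀ e ∈ S, u (X.src e) = u (X.tgt e) := fun e he ↦ by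
      have hadj : Joined (X.src e) (X.tgt e) := .rel _ _ ⟨e, he, rfl, rfl⟩
      have hiff : Joined x (X.src e) ↔ Joined x (X.tgt e) :=
        ⟨fun hx ↦ hx.trans _ _ _ hadj, fun hx ↦ hx.trans _ _ _ (hadj.symm _ _)⟩
      simp only [u, hiff]
    by_contra hxy
    have hxx : u x = a := if_pos (.refl x)
    have hy : u y = b := if_neg hxy
    exact hab (hxx.symm.trans ((h u hu x y).trans hy))

section MatrixTree

variable {R : Type*} [CommRing R] [DecidableEq V] (X : DiMultigraph V E)

theorem sum_incMatrix_eq_zero_or_eq_single [Fintype W] [DecidableEq W] {f : W → V}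
    (hf : Injective f) (e : E) :
    ∑ w, X.incMatrix R (f w) e = 0 ∨
      ∃ (w : W) (s : SignType), (fun w' ↦ X.incMatrix R (f w') e) = Pi.single w (s : R) := by
  by_cases hs : ∃ u, f u = X.src e <;> by_cases ht : ∃ v, f v = X.tgt e
  · obtain ⟨u, hu⟩ := hs
    obtain ⟨v, hv⟩ := ht
    left
    simp [incMatrix, ← hu, ← hv, hf.eq_iff]
  · obtain ⟨u, hu⟩ := hs
    have htgt (w : W) : X.tgt e ≠ f w := fun h ↦ ht ⟨w, h.symm⟩
    refine .inr ⟨u, 1, funext fun w ↦ ?_⟩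
    simp [incMatrix, ← hu, hf.eq_iff, Pi.single_apply, eq_comm (a := u), htgt]
  · obtain ⟨v, hv⟩ := ht
    have hsrc (w : W) : X.src e ≠ f w := fun h ↦ hs ⟨w, h.symm⟩
    refine .inr ⟨v, -1, funext fun w ↦ ?_⟩
    by_cases hw : v = w
    · simp [incMatrix, ← hv, hsrc, hw]
    · simp [incMatrix, ← hv, hsrc, hw, Ne.symm hw, hf.eq_iff]
  · left
    push Not at hs ht
    simp [incMatrix, eq_comm, hs, ht]

theorem isTotallyUnimodular_incMatrix [IsDomain R] : (X.incMatrix R).IsTotallyUnimodular := by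
  intro k f g hf hg
  induction k with
  | zero => exact ⟨1, by simp⟩
  | succ k ih =>
    by_cases hsum : ∀ j, ∑ i, X.incMatrix R (f i) (g j) = 0
    · refine ⟨0, (exists_vecMul_eq_zero_iff.mp ⟨1, one_ne_zero, funext fun j ↦ ?_⟩).symm⟩
      simpa [vecMul, dotProduct] using hsum j
    · push Not at hsum
      obtain ⟨j, hj⟩ := hsum
      obtain ⟨i, s, hcol⟩ :=
        (X.sum_incMatrix_eq_zero_or_eq_single hf (g j)).resolve_left hj
      rw [det_succ_column _ j, Fintype.sum_eq_single i fun i' hi' ↦ ?_]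
      · simp only [submatrix_apply, congrFun hcol i, Pi.single_eq_same]
        change _ ∈ MonoidHom.mrange (SignType.castHom (α := R)).toMonoidHom
        refine mul_mem (mul_mem (pow_mem ?_ _) ⟨s, rfl⟩)
          (ih _ _ (hf.comp Fin.succAbove_right_injective)
            (hg.comp Fin.succAbove_right_injective))
        exact ⟨-1, by simp⟩
      · have hzero : X.incMatrix R (f i') (g j) = 0 := by
          rw [congrFun hcol i', Pi.single_eq_of_ne hi']
        rw [submatrix_apply, hzero, mul_zero, zero_mul]

variable [Fintype W] {ι : W ↪ V}

theorem vecMul_submatrix_incMatrix {F : Type*} (v : W → R) (f : F → E) (j : F) :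
    (v ᵥ* (X.incMatrix R).submatrix ι f) j =
      extend ι v 0 (X.src (f j)) - extend ι v 0 (X.tgt (f j)) := by
  have hext (x : V) : ∑ w, (if x = ι w then v w else 0) = extend ι v 0 x := by
    classical
    by_cases hx : ∃ w, ι w = x
    · obtain ⟨w, rfl⟩ := hx
      simp [ι.injective.extend_apply]
    · rw [extend_apply' _ _ _ hx]
      exact sum_eq_zero fun w _ ↦ if_neg fun h ↦ hx ⟨w, h.symm⟩
  simp only [vecMul, dotProduct, submatrix_apply, incMatrix, of_apply, mul_sub, mul_ite, mul_one,
    mul_zero, sum_sub_distrib, hext]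

variable [IsDomain R] [DecidableEq W] {r : V}

theorem det_submatrix_incMatrix_ne_zero_iff_connects [DecidableEq E]
    (hι : Set.range ι = {r}ᶜ) (f : W → E) :
    ((X.incMatrix R).submatrix ι f).det ≠ 0 ↔ X.Connects (univ.image f) := by
  have hr (v : W → R) : extend ι v 0 r = 0 :=
    extend_apply' _ _ _ fun h ↦ (hι ▸ h : r ∈ ({r}ᶜ : Set V)) rfl
  refine ⟨fun hdet ↦ (connects_iff_forall_eq R).mpr fun u hu ↦ ?_, fun hf hdet ↦ ?_⟩
  · let v (w : W) : R := u (ι w) - u r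
    have hv (x : V) : extend ι v 0 x = u x - u r := by
      rcases eq_or_ne x r with rfl | hx
      · rw [hr, sub_self]
      · obtain ⟨w, rfl⟩ : x ∈ Set.range ι := hι ▸ hx
        exact ι.injective.extend_apply ..
    have hker : v = 0 := eq_zero_of_vecMul_eq_zero hdet <| funext fun j ↦ by
      rw [vecMul_submatrix_incMatrix, hv, hv, hu _ (mem_image_of_mem f (mem_univ j)), sub_self,
        Pi.zero_apply]
    have hconst (x : V) : u x = u r := by
      rw [← sub_eq_zero, ← hv, hker]
      exact congrFun (extend_const ι (0 : R)) x
    exact fun x y ↦ (hconst x).trans (hconst y).symm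
  · obtain ⟨v, hv, hker⟩ := exists_vecMul_eq_zero_iff.mpr hdet
    have hu : ∀ e ∈ univ.image f, extend ι v 0 (X.src e) = extend ι v 0 (X.tgt e) := by
      simp only [mem_image, mem_univ, true_and, forall_exists_index, forall_apply_eq_imp_iff]
      intro j
      rw [← sub_eq_zero, ← vecMul_submatrix_incMatrix, hker, Pi.zero_apply]
    refine hv (funext fun w ↦ ?_)
    rw [← ι.injective.extend_apply v 0 w, (connects_iff_forall_eq R).mp hf _ hu (ι w) r, hr,
      Pi.zero_apply]

variable [Fintype V]

theorem det_submatrix_incMatrix_ne_zero_iff_mem_spanningTrees [DecidableEq E]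
    (hι : Set.range ι = {r}ᶜ) (f : W → E) :
    ((X.incMatrix R).submatrix ι f).det ≠ 0 ↔ univ.image f ∈ X.spanningTrees := by
  refine ⟨fun hdet ↦ ⟨?_, ?_⟩, fun h ↦ ?_⟩
  · exact (X.det_submatrix_incMatrix_ne_zero_iff_connects hι f).mp hdet
  · have hf : Injective f := fun i j hij ↦ by
      by_contra hne
      exact hdet (det_zero_of_column_eq hne fun w ↦ by rw [submatrix_apply, submatrix_apply, hij])
    rw [card_image_of_injective _ hf, card_univ,
      card_add_one_of_range_eq_compl_singleton hι]
  · exact (X.det_submatrix_incMatrix_ne_zero_iff_connects hι f).mpr h.1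

theorem sq_det_submatrix_incMatrix [DecidableEq E] [DecidablePred (· ∈ X.spanningTrees)]
    (hι : Set.range ι = {r}ᶜ) (f : W → E) :
    ((X.incMatrix R).submatrix ι f).det ^ 2 =
      if univ.image f ∈ X.spanningTrees then 1 else 0 := by
  have htree := X.det_submatrix_incMatrix_ne_zero_iff_mem_spanningTrees (R := R) hι f
  obtain ⟨s, hs⟩ := (isTotallyUnimodular_iff_fintype _).mp
    (X.isTotallyUnimodular_incMatrix (R := R)) W ι f
  split_ifs with h
  · have hdet := htree.mpr h
    rw [← hs] at hdet ⊢
    cases s with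
    | zero => exact absurd SignType.coe_zero hdet
    | neg => simp
    | pos => simp
  · rw [not_not.mp (mt htree.mp h), zero_pow two_ne_zero]

theorem ncard_spanningTrees_eq_det [CharZero R] [Fintype E] (hι : Set.range ι = {r}ᶜ) :
    (X.spanningTrees.ncard : R) =
      ((X.incMatrix R).submatrix ι id * ((X.incMatrix R).submatrix ι id)ᵀ).det := by
  classical
  have hcard : ∀ S ∈ X.spanningTrees.toFinset, #S = Fintype.card W := fun S hS ↦
    Nat.succ_injective <| (Set.mem_toFinset.mp hS).2.trans
      (card_add_one_of_range_eq_compl_singleton hι).symm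
  refine mul_left_cancel₀ (Nat.cast_ne_zero.mpr (Fintype.card W).factorial_ne_zero) ?_
  calc ((Fintype.card W).factorial * X.spanningTrees.ncard : R)
      = #{f : W → E | univ.image f ∈ X.spanningTrees.toFinset} := by
        rw [card_filter_image_univ_mem hcard, Nat.cast_mul, Set.ncard_eq_toFinset_card', mul_comm]
    _ = ∑ f : W → E, ((X.incMatrix R).submatrix ι f).det ^ 2 := by
        simp only [X.sq_det_submatrix_incMatrix hι, sum_boole, Set.mem_toFinset]
    _ = _ := by
        rw [factorial_card_mul_det_mul]
        refine sum_congr rfl fun f _ ↦ ?_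
        rw [transpose_submatrix, submatrix_submatrix, submatrix_submatrix, ← transpose_submatrix,
          det_transpose, sq]
        rfl

end MatrixTree

theorem incMatrix_mul_transpose_completeBipartite (R : Type*) [Ring R] (n k : ℕ) :
    ((completeBipartite n (k + 1)).incMatrix R).submatrix (Sum.map id Fin.succ) id *
      (((completeBipartite n (k + 1)).incMatrix R).submatrix (Sum.map id Fin.succ) id)ᵀ =
      fromBlocks ((k + 1 : R) • 1) (of fun _ _ ↦ -1) (of fun _ _ ↦ -1) ((n : R) • 1) := by
  ext (a | i) (b | j) <;>
    simp [mul_apply, incMatrix, completeBipartite, Fintype.sum_prod_type, Matrix.one_apply,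
      eq_comm, apply_ite Finset.card]

theorem ncard_spanningTrees_completeBipartite (n k : ℕ) :
    (completeBipartite (n + 1) (k + 1)).spanningTrees.ncard = (n + 1) ^ k * (k + 1) ^ n := by
  let ι : Fin (n + 1) ⊕ Fin k ↪ Fin (n + 1) ⊕ Fin (k + 1) :=
    Embedding.sumMap (.refl _) (Fin.succEmb k)
  have hι : Set.range ι = {Sum.inr 0}ᶜ := by
    ext (a | b)
    · simp [ι]
    · simp [ι, Fin.exists_succ_eq]
  have hn : ((n + 1 : ℕ) : ℚ) ≠ 0 := by positivity
  have hk : (k + 1 : ℚ) ≠ 0 := by positivity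
  rw [← Nat.cast_inj (R := ℚ), ncard_spanningTrees_eq_det _ hι]
  refine (congrArg det (incMatrix_mul_transpose_completeBipartite ℚ (n + 1) k)).trans ?_
  rw [det_fromBlocks_smul_one_neg_one hk hn, Fintype.card_fin, Fintype.card_fin]
  push_cast
  field_simp
  ring

end DiMultigraph

theorem image_extremePoints_of_injective {𝕜 E F : Type*} [Ring 𝕜] [PartialOrder 𝕜]
    [IsOrderedRing 𝕜] [AddCommGroup E] [Module 𝕜 E] [AddCommGroup F] [Module 𝕜 F] {f : E →ₗ[𝕜] F}
    (hf : Injective f) (s : Set E) : f '' s.extremePoints 𝕜 = (f '' s).extremePoints 𝕜 := by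
  have hseg (x y : E) : f '' openSegment 𝕜 x y = openSegment 𝕜 (f x) (f y) :=
    image_openSegment 𝕜 f.toAffineMap x y
  have hmem (x : E) : f x ∈ (f '' s).extremePoints 𝕜 ↔ x ∈ s.extremePoints 𝕜 := by
    simp only [mem_extremePoints, Set.forall_mem_image, hf.mem_set_image, hf.eq_iff, ← hseg]
  ext y
  refine ⟨?_, fun hy ↦ ?_⟩
  · rintro ⟨x, hx, rfl⟩
    exact (hmem x).mpr hx
  · obtain ⟨x, -, rfl⟩ := hy.1
    exact ⟨x, (hmem x).mp hy, rfl⟩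

section Collapsed

variable {m : ℕ}

/-- The collapsed distribution on pairs of outcomes whose marginals are both equal to a given
vector, as a linear function of that vector. -/
def diagDist (m : ℕ) : (Fin m → ℝ) →ₗ[ℝ] Fin m × Fin m → ℝ where
  toFun q ab := if ab.1 = ab.2 then q ab.1 else 0
  map_add' q r := by ext; simp only [Pi.add_apply]; split_ifs <;> simp
  map_smul' c q := by ext; simp

theorem diagDist_apply (q : Fin m → ℝ) (a b : Fin m) :
    diagDist m q (a, b) = if a = b then q a else 0 := rfl

theorem isCollapsed_diagDist (q : Fin m → ℝ) : IsCollapsed (diagDist m q) :=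
  fun _ _ h ↦ if_neg h

theorem diagDist_mem_stdSimplex {q : Fin m → ℝ} (hq : q ∈ stdSimplex ℝ (Fin m)) :
    diagDist m q ∈ stdSimplex ℝ (Fin m × Fin m) := by
  refine ⟨fun (a, b) ↦ ?_, ?_⟩
  · rw [diagDist_apply]
    split_ifs
    exacts [hq.1 a, le_rfl]
  · simpa [Fintype.sum_prod_type, diagDist_apply] using hq.2

theorem IsCollapsed.sum_row {Q : Fin m × Fin m → ℝ} (hQ : IsCollapsed Q) (a : Fin m) :
    ∑ b, Q (a, b) = Q (a, a) :=
  Fintype.sum_eq_single a fun b hb ↦ hQ a b hb.symm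

theorem IsCollapsed.sum_col {Q : Fin m × Fin m → ℝ} (hQ : IsCollapsed Q) (b : Fin m) :
    ∑ a, Q (a, b) = Q (b, b) :=
  Fintype.sum_eq_single b fun a ha ↦ hQ a b ha

theorem IsCollapsed.eq_diagDist {Q : Fin m × Fin m → ℝ} (hQ : IsCollapsed Q) :
    Q = diagDist m fun a ↦ ∑ b, Q (a, b) := by
  ext ⟨a, b⟩
  rw [diagDist_apply]
  split_ifs with h
  · rw [hQ.sum_row, h]
  · exact hQ a b h

end Collapsed

namespace DiMultigraph

/-- The ambient vector space of the polytopes of distributions on graphs with nodes `V` and edges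
`E`. -/
abbrev DistSpace (V E : Type*) (m : ℕ) : Type _ :=
  (V → Fin m → ℝ) × (E → Fin m × Fin m → ℝ)

section Expand

variable {V E : Type*} {n m : ℕ}

theorem convex_distPolytope (X : DiMultigraph V E) (m : ℕ) : Convex ℝ (X.distPolytope m) := by
  rintro p ⟨hpnode, hpedge, hprow, hpcol⟩ q ⟨hqnode, hqedge, hqrow, hqcol⟩ α β hα hβ hαβ
  refine ⟨fun x ↦ convex_stdSimplex ℝ _ (hpnode x) (hqnode x) hα hβ hαβ,
    fun e ↦ convex_stdSimplex ℝ _ (hpedge e) (hqedge e) hα hβ hαβ, fun e a ↦ ?_, fun e b ↦ ?_⟩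
  · simp [hprow, hqrow, sum_add_distrib, mul_sum]
  · simp [hpcol, hqcol, sum_add_distrib, mul_sum]

theorem contextualVertices_eq_diff (X : DiMultigraph V E) (m : ℕ) :
    X.contextualVertices m = (X.distPolytope m).extremePoints ℝ \ X.deterministic m := by
  have hsub : convexHull ℝ (X.deterministic m) ⊆ X.distPolytope m :=
    convexHull_min (fun _ hq ↦ hq.1) (X.convex_distPolytope m)
  ext p
  refine and_congr_right fun hp ↦ not_congr ⟨fun h ↦ ?_, fun h ↦ subset_convexHull ℝ _ h⟩
  exact extremePoints_convexHull_subset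
    (inter_extremePoints_subset_extremePoints_of_subset hsub ⟨h, hp⟩)

/-- The face of the polytope of distributions on `X` consisting of those that are collapsed on every
edge in `S`. -/
def collapsedFace (X : DiMultigraph V E) (m : ℕ) (S : Finset E) : Set (DistSpace V E m) :=
  {q ∈ X.distPolytope m | ∀ e ∈ S, IsCollapsed (q.2 e)}

theorem isExtreme_collapsedFace (X : DiMultigraph V E) (m : ℕ) (S : Finset E) :
    IsExtreme ℝ (X.distPolytope m) (X.collapsedFace m S) := by
  refine ⟨fun _ hq ↦ hq.1, ?_⟩
  rintro q hq r hr p ⟨-, hp⟩ ⟨α, β, hα, hβ, -, rfl⟩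
  refine ⟨hq, fun e he a b hab ↦ ?_⟩
  have hsum : α * q.2 e (a, b) + β * r.2 e (a, b) = 0 := hp e he a b hab
  have hqe := mul_nonneg hα.le ((hq.2.1 e).1 (a, b))
  have hre := mul_nonneg hβ.le ((hr.2.1 e).1 (a, b))
  exact (mul_eq_zero.mp (by linarith)).resolve_left hα.ne'

theorem fst_eq_fst_of_mem_collapsedFace {X : DiMultigraph V E} {S : Finset E} (hS : X.Connects S)
    {q : DistSpace V E m} (hq : q ∈ X.collapsedFace m S) (x y : V) : q.1 x = q.1 y := by
  obtain ⟨⟨-, -, hrow, hcol⟩, hcoll⟩ := hq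
  ext a
  refine (connects_iff_forall_eq ℝ).mp hS (fun z ↦ q.1 z a) (fun e he ↦ ?_) x y
  rw [hrow, hcol, (hcoll e he).sum_row, (hcoll e he).sum_col]

variable [DecidableEq E] {S : Finset E} (η : {e // e ∉ S} ≃ Fin n)

/-- The distribution on a graph with nodes `V` and edges `E` induced by a distribution on the rose
that arises by contracting the edges in `S`; the loop `η e` of the rose stands for the edge `e`. -/
def expand (V : Type*) (m : ℕ) : DistSpace Unit (Fin n) m →ₗ[ℝ] DistSpace V E m where
  toFun p :=
    (fun _ ↦ p.1 (), fun e ↦ if h : e ∈ S then diagDist m (p.1 ()) else p.2 (η ⟨e, h⟩))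
  map_add' p q := by
    refine Prod.ext rfl (funext fun e ↦ ?_)
    by_cases h : e ∈ S <;> simp [h]
  map_smul' c p := by
    refine Prod.ext rfl (funext fun e ↦ ?_)
    by_cases h : e ∈ S <;> simp [h]

variable {η}

theorem expand_fst (p : DistSpace Unit (Fin n) m) (x : V) : (expand η V m p).1 x = p.1 () := rfl

theorem expand_snd_of_mem {e : E} (h : e ∈ S) (p : DistSpace Unit (Fin n) m) :
    (expand η V m p).2 e = diagDist m (p.1 ()) := dif_pos h

theorem expand_snd_of_notMem {e : E} (h : e ∉ S) (p : DistSpace Unit (Fin n) m) :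
    (expand η V m p).2 e = p.2 (η ⟨e, h⟩) := dif_neg h

theorem expand_snd_symm (p : DistSpace Unit (Fin n) m) (i : Fin n) :
    (expand η V m p).2 (η.symm i) = p.2 i := by
  rw [expand_snd_of_notMem (η.symm i).2, Subtype.coe_eta, η.apply_symm_apply]

theorem expand_injective [Nonempty V] : Injective (expand η V m) := by
  intro p q h
  obtain ⟨x⟩ := ‹Nonempty V›
  refine Prod.ext (funext fun _ ↦ congrFun (congrArg Prod.fst h) x) (funext fun i ↦ ?_)
  rw [← expand_snd_symm (η := η) (V := V) p, h, expand_snd_symm]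

theorem expand_mem_collapsedFace (X : DiMultigraph V E) {p : DistSpace Unit (Fin n) m}
    (hp : p ∈ (rose n).distPolytope m) : expand η V m p ∈ X.collapsedFace m S := by
  obtain ⟨hnode, hedge, hrow, hcol⟩ := hp
  refine ⟨⟨fun _ ↦ hnode (), fun e ↦ ?_, fun e a ↦ ?_, fun e b ↦ ?_⟩, fun e he ↦ ?_⟩
  · by_cases h : e ∈ S
    · exact expand_snd_of_mem (V := V) (η := η) h p ▸ diagDist_mem_stdSimplex (hnode ())
    · exact expand_snd_of_notMem (V := V) (η := η) h p ▸ hedge _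
  · by_cases h : e ∈ S
    · simp [expand_fst, expand_snd_of_mem h, diagDist_apply]
    · rw [expand_fst, expand_snd_of_notMem h]
      exact hrow (η ⟨e, h⟩) a
  · by_cases h : e ∈ S
    · simp [expand_fst, expand_snd_of_mem h, diagDist_apply]
    · rw [expand_fst, expand_snd_of_notMem h]
      exact hcol (η ⟨e, h⟩) b
  · rw [expand_snd_of_mem he]
    exact isCollapsed_diagDist _

theorem image_expand_distPolytope [Nonempty V] {X : DiMultigraph V E} (hS : X.Connects S) :
    expand η V m '' (rose n).distPolytope m = X.collapsedFace m S := by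
  refine Set.Subset.antisymm (Set.image_subset_iff.mpr fun p ↦ expand_mem_collapsedFace X) ?_
  intro q hq
  obtain ⟨x⟩ := ‹Nonempty V›
  have hconst (y : V) : q.1 y = q.1 x := fst_eq_fst_of_mem_collapsedFace hS hq y x
  obtain ⟨⟨hnode, hedge, hrow, hcol⟩, hcoll⟩ := hq
  refine ⟨(fun _ ↦ q.1 x, fun i ↦ q.2 (η.symm i)), ⟨fun _ ↦ hnode x, fun i ↦ hedge _, ?_, ?_⟩, ?_⟩
  · exact fun i a ↦ (congrFun (hconst _) a).symm.trans (hrow (η.symm i) a)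
  · exact fun i b ↦ (congrFun (hconst _) b).symm.trans (hcol (η.symm i) b)
  · refine Prod.ext (funext fun y ↦ (hconst y).symm) (funext fun e ↦ ?_)
    by_cases h : e ∈ S
    · rw [expand_snd_of_mem h, (hcoll e h).eq_diagDist, ← hconst (X.src e)]
      exact congrArg _ (funext (hrow e))
    · exact expand_snd_of_notMem h _ |>.trans <|
        congrArg (fun e' : {e // e ∉ S} ↦ q.2 e') (η.symm_apply_apply ⟨e, h⟩)

theorem expand_mem_contextualVertices [Nonempty V] {X : DiMultigraph V E} (hS : X.Connects S)
    {p : DistSpace Unit (Fin n) m} (hp : p ∈ (rose n).contextualVertices m) :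
    expand η V m p ∈ X.contextualVertices m := by
  rw [contextualVertices_eq_diff] at hp ⊢
  obtain ⟨hvertex, hndet⟩ := hp
  have hface : expand η V m p ∈ (X.collapsedFace m S).extremePoints ℝ := by
    rw [← image_expand_distPolytope (η := η) hS,
      ← image_extremePoints_of_injective expand_injective]
    exact Set.mem_image_of_mem _ hvertex
  refine ⟨(X.isExtreme_collapsedFace m S).extremePoints_subset_extremePoints hface, ?_⟩
  rintro ⟨-, hnode, hedge⟩
  refine hndet ⟨hvertex.1, fun _ ↦ hnode (Classical.arbitrary V), fun i ↦ ?_⟩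
  rw [← expand_snd_symm (η := η) (V := V) p]
  exact hedge _

theorem isCollapsed_expand_iff {p : DistSpace Unit (Fin n) m}
    (hp : ∀ i, ¬ IsCollapsed (p.2 i)) (e : E) :
    IsCollapsed ((expand η V m p).2 e) ↔ e ∈ S := by
  by_cases h : e ∈ S
  · simp only [h, expand_snd_of_mem h, isCollapsed_diagDist]
  · simp only [h, expand_snd_of_notMem h, hp]

end Expand

theorem kappaTilde_mul_encard_spanningTrees_le {V E : Type*} [Fintype V] [Fintype E] [Nonempty V]
    (X : DiMultigraph V E) {n : ℕ} (hn : Fintype.card V + n = Fintype.card E + 1) (m : ℕ) :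
    kappaTilde n m * X.spanningTrees.encard ≤ (X.contextualVertices m).encard := by
  classical
  have hη (S : Finset E) (hS : S ∈ X.spanningTrees) : Nonempty ({e // e ∉ S} ≃ Fin n) := by
    refine ⟨Fintype.equivFinOfCardEq ?_⟩
    have hcard := hS.2
    rw [Fintype.card_subtype_compl, Fintype.card_coe]
    omega
  let lift (z : DistSpace Unit (Fin n) m × Finset E) : DistSpace V E m :=
    if hS : z.2 ∈ X.spanningTrees then expand (hη z.2 hS).some V m z.1 else 0
  have hlift (p : DistSpace Unit (Fin n) m) {S : Finset E} (hS : S ∈ X.spanningTrees) :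
      lift (p, S) = expand (hη S hS).some V m p := dif_pos hS
  rw [kappaTilde, ← Set.encard_prod]
  refine Set.encard_le_encard_of_injOn (f := lift) ?_ ?_
  · rintro ⟨p, S⟩ ⟨hp, hS⟩
    rw [hlift p hS]
    exact expand_mem_contextualVertices hS.1 hp.1
  · rintro ⟨p, S⟩ ⟨hp, hS⟩ ⟨q, T⟩ ⟨hq, hT⟩ h
    rw [hlift p hS, hlift q hT] at h
    obtain rfl : S = T := by
      ext e
      rw [← isCollapsed_expand_iff (V := V) hp.2 e, h, isCollapsed_expand_iff hq.2 e]
    rw [expand_injective h]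

end DiMultigraph

theorem corollary6p5 (n₁ n₂ m : ℕ) (hn₁ : 1 ≤ n₁) (hn₂ : 1 ≤ n₂) (hm : 2 ≤ m) :
    kappaTilde ((n₁ - 1) * (n₂ - 1)) m * ((n₁ ^ (n₂ - 1) * n₂ ^ (n₁ - 1) : ℕ) : ℕ∞) ≤
      ((DiMultigraph.completeBipartite n₁ n₂).contextualVertices m).encard := by
  obtain ⟨n, rfl⟩ := Nat.exists_eq_add_of_le' hn₁
  obtain ⟨k, rfl⟩ := Nat.exists_eq_add_of_le' hn₂
  have hcard : Fintype.card (Fin (n + 1) ⊕ Fin (k + 1)) + n * k =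
      Fintype.card (Fin (n + 1) × Fin (k + 1)) + 1 := by
    simp only [Fintype.card_sum, Fintype.card_prod, Fintype.card_fin]
    ring
  simp only [Nat.add_sub_cancel]
  rw [← DiMultigraph.ncard_spanningTrees_completeBipartite, (Set.toFinite _).cast_ncard_eq]
  exact DiMultigraph.kappaTilde_mul_encard_spanningTrees_le _ hcard m
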